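/- Let $n\ge 0$ be an integer. Let $P_3(n)$ denote the number of partitions of $n$ into distinct parts, each congruent to $-2^3,-2^2,-2^1$ or $-2^0 \pmod{15}$. Let $G_3(n)$ denote the number of partitions of $n$ satisfying all of the following conditions: (i) no part is $\equiv 2^3,2^2,2^1$ or $2^0\pmod{15}$; (ii) any two parts that are not multiples of $15$ differ by at least $15$, with equality only if a part is $\equiv -2^3,-2^2,-2^1$ or $-2^0\pmod{15}$; (iii) every part that is $\not\equiv -2^3,-2^2,-2^1,-2^0\pmod{15}$ is $>15$; (iv) any two parts that are multiples of $15$ differ by at least $60$; (v) if some part is a multiple of $15$, then the smallest such part is $\ge 30+30\tau$ if $7$ is a part, and $\ge 45+30\tau$ otherwise, where $\tau$ is the number of parts that are not multiples of $15$. Then $G_3(n)=P_3(n)$. -/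

import Mathlib

/-- `m` lies in one of the classes `-2^3, -2^2, -2^1, -2^0` modulo `15`. -/
def IsNegPowClass (m : ℕ) : Prop :=
  (m : ℤ) ≡ -2 ^ 3 [ZMOD 15] ∨ (m : ℤ) ≡ -2 ^ 2 [ZMOD 15] ∨
    (m : ℤ) ≡ -2 ^ 1 [ZMOD 15] ∨ (m : ℤ) ≡ -2 ^ 0 [ZMOD 15]

instance (m : ℕ) : Decidable (IsNegPowClass m) := by
  unfold IsNegPowClass; infer_instance

/-- `m` lies in one of the classes `2^3, 2^2, 2^1, 2^0` modulo `15`. -/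
def IsPosPowClass (m : ℕ) : Prop :=
  (m : ℤ) ≡ 2 ^ 3 [ZMOD 15] ∨ (m : ℤ) ≡ 2 ^ 2 [ZMOD 15] ∨
    (m : ℤ) ≡ 2 ^ 1 [ZMOD 15] ∨ (m : ℤ) ≡ 2 ^ 0 [ZMOD 15]

instance (m : ℕ) : Decidable (IsPosPowClass m) := by
  unfold IsPosPowClass; infer_instance

/-- The parts are distinct and all lie in the classes `-2^3, -2^2, -2^1, -2^0` modulo `15`. -/
def IsPThree (s : Multiset ℕ) : Prop :=
  s.Nodup ∧ ∀ x ∈ s, IsNegPowClass x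

instance (s : Multiset ℕ) : Decidable (IsPThree s) := by
  unfold IsPThree; infer_instance

/-- The sub-multiset of the parts that are multiples of `15`. -/
def multiplesPart (s : Multiset ℕ) : Multiset ℕ := s.filter (fun x => 15 ∣ x)

/-- The sub-multiset of the parts that are not multiples of `15`. -/
def nonMultiplesPart (s : Multiset ℕ) : Multiset ℕ := s.filter (fun x => ¬ 15 ∣ x)

/-- The difference and congruence conditions on a multiset of parts. Two parts of a multiset `t`
are given as `x ∈ t` and `y ∈ t.erase x`, so that repeated parts count as parts with
difference `0`. -/
structure IsGThree (s : Multiset ℕ) : Prop where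
  /-- No part is congruent to `2^3, 2^2, 2^1` or `2^0` modulo `15`. -/
  not_pos : ∀ x ∈ s, ¬ IsPosPowClass x
  /-- Parts that are not multiples of `15` differ by at least `15`, with equality only if a part
  (equivalently, each of the two) is in a class `-2^3, -2^2, -2^1, -2^0`. -/
  gap : ∀ x ∈ nonMultiplesPart s, ∀ y ∈ (nonMultiplesPart s).erase x, x ≤ y →
    x + 15 ≤ y ∧ (y = x + 15 → IsNegPowClass x ∨ IsNegPowClass y)
  /-- Parts outside the classes `-2^3, -2^2, -2^1, -2^0` exceed `15`. -/
  large : ∀ x ∈ s, ¬ IsNegPowClass x → 15 < x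
  /-- Multiples of `15` differ by at least `60`. -/
  gap_mult : ∀ x ∈ multiplesPart s, ∀ y ∈ (multiplesPart s).erase x, x ≤ y → x + 60 ≤ y
  /-- The lower bound for the multiples of `15`. -/
  lower : ∀ x ∈ multiplesPart s,
    (if 7 ∈ s then 30 else 45) + 30 * (nonMultiplesPart s).card ≤ x

instance (s : Multiset ℕ) : Decidable (IsGThree s) :=
  decidable_of_iff
    ((∀ x ∈ s, ¬ IsPosPowClass x) ∧
      (∀ x ∈ nonMultiplesPart s, ∀ y ∈ (nonMultiplesPart s).erase x, x ≤ y →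
        x + 15 ≤ y ∧ (y = x + 15 → IsNegPowClass x ∨ IsNegPowClass y)) ∧
      (∀ x ∈ s, ¬ IsNegPowClass x → 15 < x) ∧
      (∀ x ∈ multiplesPart s, ∀ y ∈ (multiplesPart s).erase x, x ≤ y → x + 60 ≤ y) ∧
      (∀ x ∈ multiplesPart s,
        (if 7 ∈ s then 30 else 45) + 30 * (nonMultiplesPart s).card ≤ x))
    ⟨fun ⟨h1, h2, h3, h4, h5⟩ => ⟨h1, h2, h3, h4, h5⟩,
      fun ⟨h1, h2, h3, h4, h5⟩ => ⟨h1, h2, h3, h4, h5⟩⟩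

/-- The number of partitions of `n` into distinct parts congruent to `-2^3, -2^2, -2^1` or
`-2^0` modulo `15`. -/
def PThree (n : ℕ) : ℕ :=
  (Finset.univ.filter (fun p : Nat.Partition n => IsPThree p.parts)).card

/-- The number of partitions of `n` satisfying the difference and congruence conditions. -/
def GThree (n : ℕ) : ℕ :=
  (Finset.univ.filter (fun p : Nat.Partition n => IsGThree p.parts)).card

/-!
Fix the number `k` of parts that are not multiples of `15` and subtract the staircase
`0, 15, …, 15 (k - 1)` from them: the gap condition disappears, and what remains are parts `≡ 7, 11,
13, 14` which may be repeated and parts `≡ 3, 5, 6, 9, 10, 12` which may not. Marking the number of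
parts by `Y`, these have an infinite product as generating function, and putting the staircase back
amounts to the linear functional `Λ : Y ^ k ↦ p ^ (k.choose 2)` with `p = q ^ 15`. A multiple of
`15` behaves like two parts: gaps of at least `60` and the bound `30 τ` are exactly what `Λ`
produces from the product of `1 / (1 - ε p ^ t Y ^ 2)`.

The residues `3, …, 12` are the sums of two different residues among `7, 11, 13, 14`, and so the
product lives over four free parameters `a, b, c, d` in place of `q ^ 7, q ^ 11, q ^ 13, q ^ 14`,
with `a b c d = p ^ 2 ε`. Let `F(a, b, c, d)` be the value of `Λ` on it, with the correction for the
smallest parts. Since `Λ (Z (p Y)) = Λ (Y Z (Y))` for every series `Z`, a suitable `Z` gives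
`F(a, b, c, d) = (1 + a) F(a p, b, c, d)`. By symmetry all four parameters can be scaled in turn,
and letting them tend to `0` gives the product `∏ t, (1 + a p ^ t) (1 + b p ^ t) (1 + c p ^ t)
(1 + d p ^ t)`, which is the generating function of `PThree`.
-/

namespace GollnitzFour

open PowerSeries Finset

section QSeries

variable {R S : Type*} [CommRing R] [CommRing S] {p : R}

/-- The reciprocal `1 / ((1 - p) (1 - p ^ 2) ⋯ (1 - p ^ n))` of a `q`-Pochhammer symbol. It has the
junk value `0` if one of the factors is not a unit. -/
noncomputable def invPochhammer (p : R) (n : ℕ) : R :=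
  ∏ k ∈ range n, Ring.inverse (1 - p ^ (k + 1))

theorem invPochhammer_zero : invPochhammer p 0 = 1 := prod_range_zero _

theorem one_sub_pow_mul_invPochhammer {n : ℕ} (h : IsUnit (1 - p ^ (n + 1))) :
    (1 - p ^ (n + 1)) * invPochhammer p (n + 1) = invPochhammer p n := by
  rw [invPochhammer, prod_range_succ, mul_left_comm, Ring.mul_inverse_cancel _ h, mul_one,
    invPochhammer]

/-- The infinite product `∏ t, (1 + c p ^ t X)`, encoded by Euler's expansion. -/
noncomputable def prodSeries (p c : R) : R⟦X⟧ :=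
  PowerSeries.mk fun n => p ^ n.choose 2 * c ^ n * invPochhammer p n

/-- The infinite product `∏ t, 1 / (1 - c p ^ t X)`, encoded by Euler's expansion. -/
noncomputable def invSeries (p c : R) : R⟦X⟧ :=
  PowerSeries.mk fun n => c ^ n * invPochhammer p n

/-- The infinite product `∏ t, 1 / (1 - c p ^ t X ^ 2)`. -/
noncomputable def invSqSeries (p c : R) : R⟦X⟧ := expand 2 two_ne_zero (invSeries p c)

theorem constantCoeff_prodSeries (p c : R) : constantCoeff (prodSeries p c) = 1 := by
  simp [prodSeries, invPochhammer_zero]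

theorem constantCoeff_invSeries (p c : R) : constantCoeff (invSeries p c) = 1 := by
  simp [invSeries, invPochhammer_zero]

theorem one_add_mul_prodSeries (hp : ∀ n, IsUnit (1 - p ^ (n + 1))) (c : R) :
    (1 + C c * X) * prodSeries p (c * p) = prodSeries p c := by
  ext n
  rcases n with _ | n
  · simp [prodSeries, add_mul, mul_assoc]
  · simp only [prodSeries, add_mul, one_mul, mul_assoc, map_add, coeff_C_mul, coeff_succ_X_mul,
      coeff_mk, Nat.choose_succ_succ' n 1, Nat.choose_one_right]
    rw [← one_sub_pow_mul_invPochhammer (hp n)]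
    ring

theorem one_sub_mul_invSeries (hp : ∀ n, IsUnit (1 - p ^ (n + 1))) (c : R) :
    (1 - C c * X) * invSeries p c = invSeries p (c * p) := by
  ext n
  rcases n with _ | n
  · simp [invSeries, sub_mul, mul_assoc]
  · simp only [invSeries, sub_mul, one_mul, mul_assoc, map_sub, coeff_C_mul, coeff_succ_X_mul,
      coeff_mk]
    rw [← one_sub_pow_mul_invPochhammer (hp n)]
    ring

theorem one_sub_mul_invSqSeries (hp : ∀ n, IsUnit (1 - p ^ (n + 1))) (c : R) :
    (1 - C c * X ^ 2) * invSqSeries p c = invSqSeries p (c * p) := by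
  rw [invSqSeries, invSqSeries, ← one_sub_mul_invSeries hp, map_mul, map_sub, map_mul, map_one,
    expand_C, expand_X]

theorem rescale_C (p c : R) : rescale p (C c) = C c := by
  ext n
  rcases n with _ | n <;> simp [coeff_C]

theorem rescale_prodSeries (p c : R) : rescale p (prodSeries p c) = prodSeries p (c * p) := by
  ext n
  simp only [prodSeries, coeff_rescale, coeff_mk]
  ring

theorem rescale_invSeries (p c : R) : rescale p (invSeries p c) = invSeries p (c * p) := by
  ext n
  simp only [invSeries, coeff_rescale, coeff_mk]
  ring

theorem rescale_invSqSeries (p c : R) :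
    rescale p (invSqSeries p c) = invSqSeries p (c * p * p) := by
  ext n
  simp only [invSqSeries, invSeries, coeff_rescale, coeff_expand, coeff_mk]
  split_ifs with h
  · obtain ⟨m, rfl⟩ := h
    rw [Nat.mul_div_cancel_left m two_pos]
    ring
  · rw [mul_zero]

theorem map_prodSeries_of_eq_zero {φ : R →+* S} {c : R} (h : φ c = 0) :
    (prodSeries p c).map φ = 1 := by
  ext n
  rcases n with _ | n <;> simp [prodSeries, h, invPochhammer_zero, PowerSeries.coeff_one]

theorem map_invSeries_of_eq_zero {φ : R →+* S} {c : R} (h : φ c = 0) :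
    (invSeries p c).map φ = 1 := by
  ext n
  rcases n with _ | n <;> simp [invSeries, h, invPochhammer_zero, PowerSeries.coeff_one]

theorem map_invSqSeries_of_eq_zero {φ : R →+* S} {c : R} (h : φ c = 0) :
    (invSqSeries p c).map φ = 1 := by
  rw [invSqSeries, map_expand, map_invSeries_of_eq_zero h, map_one]

/-- The linear functional `X ^ k ↦ p ^ (k.choose 2)` on the terms of degree `k`. The exponent is
that of a staircase: a sum over `k` parts grows by it when `0, 1, …, k - 1` are added to them. -/
noncomputable def stairCoeff (p : R) (k : ℕ) : R⟦X⟧ →ₗ[R] R := p ^ k.choose 2 • coeff k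

theorem stairCoeff_apply (p : R) (k : ℕ) (f : R⟦X⟧) :
    stairCoeff p k f = p ^ k.choose 2 * coeff k f := rfl

theorem stairCoeff_zero (p : R) (f : R⟦X⟧) : stairCoeff p 0 f = constantCoeff f := by
  simp [stairCoeff_apply]

theorem stairCoeff_X_mul (p : R) (k : ℕ) (f : R⟦X⟧) :
    stairCoeff p (k + 1) (X * f) = p ^ k * stairCoeff p k f := by
  rw [stairCoeff_apply, stairCoeff_apply, coeff_succ_X_mul, Nat.choose_succ_succ' k 1,
    Nat.choose_one_right, pow_add, mul_assoc]

theorem stairCoeff_C_mul_X_mul (p c : R) (k : ℕ) (f : R⟦X⟧) :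
    stairCoeff p (k + 1) (C c * (X * f)) = c * (p ^ k * stairCoeff p k f) := by
  rw [← smul_eq_C_mul, map_smul, stairCoeff_X_mul, smul_eq_mul]

theorem stairCoeff_rescale (p : R) (k : ℕ) (f : R⟦X⟧) :
    stairCoeff p k (rescale p f) = p ^ k * stairCoeff p k f := by
  rw [stairCoeff_apply, stairCoeff_apply, coeff_rescale, mul_left_comm]

/-- The functional `X ^ k ↦ p ^ (k.choose 2)`, truncated to the terms of degree less than `B`. -/
noncomputable def stairSum (p : R) (B : ℕ) : R⟦X⟧ →ₗ[R] R := ∑ k ∈ range B, stairCoeff p k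

theorem stairSum_apply (p : R) (B : ℕ) (f : R⟦X⟧) :
    stairSum p B f = ∑ k ∈ range B, stairCoeff p k f := LinearMap.sum_apply _ _ _

theorem stairSum_C_mul (p c : R) (B : ℕ) (f : R⟦X⟧) :
    stairSum p B (C c * f) = c * stairSum p B f := by
  rw [← smul_eq_C_mul, map_smul, smul_eq_mul]

theorem stairSum_rescale_sub_X_mul (p : R) (B : ℕ) (f : R⟦X⟧) :
    stairSum p (B + 1) (rescale p f - X * f) = p ^ (B + 1).choose 2 * coeff B f := by
  have shift (k : ℕ) : stairCoeff p k (rescale p f - X * f) =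
      stairCoeff p (k + 1) (X * f) - stairCoeff p k (X * f) := by
    rw [map_sub, stairCoeff_rescale, stairCoeff_X_mul]
  rw [stairSum_apply, sum_congr rfl fun k _ => shift k,
    sum_range_sub (fun k => stairCoeff p k (X * f)), stairCoeff_zero,
    map_mul constantCoeff, constantCoeff_X, zero_mul, sub_zero, stairCoeff_apply, coeff_succ_X_mul]

end QSeries

section Quadruple

variable {R S : Type*} [CommRing R] [CommRing S] {p a b c d ε : R}

/-- The infinite product over four repeatable primary colours `a, b, c, d` and their six
non-repeatable secondary colours `ab, …, cd`. -/
noncomputable def colourProd (p a b c d : R) : R⟦X⟧ :=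
  prodSeries p (a * b) * prodSeries p (a * c) * prodSeries p (a * d) * prodSeries p (b * c) *
    prodSeries p (b * d) * prodSeries p (c * d) *
    (invSeries p a * invSeries p b * invSeries p c * invSeries p d)

/-- `colourProd` with a further repeatable colour `ε` whose parts count twice. -/
noncomputable def quadProd (p a b c d ε : R) : R⟦X⟧ := colourProd p a b c d * invSqSeries p ε

/-- The polynomial in the part-counting variable `x` by which the product over the colours has to
be multiplied to account for the conditions on the smallest parts. It carries an extra factor `p`,
so that no division occurs. -/
def boundaryPoly (p a b c d ε x : S) : S :=
  p + (a * b * c + a * b * d + a * c * d + b * c * d - p * ε) * x ^ 2 +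
    p * ε * (a + b + c + d - p) * x ^ 3 + p ^ 2 * ε ^ 2 * x ^ 5

/-- The factor of `quadProd` which it shares with `quadProd p (a * p) b c d (ε * p)`. -/
noncomputable def commonProd (p a b c d ε : R) : R⟦X⟧ :=
  prodSeries p (a * b * p) * prodSeries p (a * c * p) * prodSeries p (a * d * p) *
    prodSeries p (b * c) * prodSeries p (b * d) * prodSeries p (c * d) *
    (invSeries p a * invSeries p b * invSeries p c * invSeries p d) * invSqSeries p ε

/-- The series `Z` whose difference `Z(pX) - X Z(X)` exhibits the recursion of `quadSum` as a
telescoping sum. -/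
noncomputable def telescoper (p a b c d ε : R) : R⟦X⟧ :=
  quadProd p a b c d ε *
    ((C p + C (b * c) * X) * (C p + C (b * d) * X) * (C p + C (c * d) * X))

theorem colourProd_rotate (p a b c d : R) : colourProd p a b c d = colourProd p b c d a := by
  simp only [colourProd, mul_comm b a, mul_comm c a, mul_comm d a]
  ring

theorem boundaryPoly_rotate (p a b c d ε x : S) :
    boundaryPoly p a b c d ε x = boundaryPoly p b c d a ε x := by
  simp only [boundaryPoly]
  ring

theorem quadProd_eq_mul_commonProd (hp : ∀ n, IsUnit (1 - p ^ (n + 1))) (a b c d ε : R) :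
    quadProd p a b c d ε =
      (1 + C a * C b * X) * (1 + C a * C c * X) * (1 + C a * C d * X) *
        commonProd p a b c d ε := by
  rw [quadProd, colourProd, commonProd, ← one_add_mul_prodSeries hp (a * b),
    ← one_add_mul_prodSeries hp (a * c), ← one_add_mul_prodSeries hp (a * d)]
  simp only [map_mul]
  ac_rfl

theorem quadProd_mul_eq_mul_commonProd (hp : ∀ n, IsUnit (1 - p ^ (n + 1))) (a b c d ε : R) :
    quadProd p (a * p) b c d (ε * p) =
      (1 - C a * X) * (1 - C ε * X ^ 2) * commonProd p a b c d ε := by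
  rw [quadProd, colourProd, commonProd, mul_right_comm a p b, mul_right_comm a p c,
    mul_right_comm a p d, ← one_sub_mul_invSeries hp a, ← one_sub_mul_invSqSeries hp ε]
  ac_rfl

theorem rescale_quadProd (hp : ∀ n, IsUnit (1 - p ^ (n + 1))) (a b c d ε : R) :
    (1 + C b * C c * X) * (1 + C b * C d * X) * (1 + C c * C d * X) *
        rescale p (quadProd p a b c d ε) =
      (1 - C a * X) * (1 - C b * X) * (1 - C c * X) * (1 - C d * X) *
        ((1 - C ε * C p * X ^ 2) * (1 - C ε * X ^ 2)) * commonProd p a b c d ε := by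
  rw [quadProd, colourProd, commonProd]
  simp only [map_mul (rescale p), rescale_prodSeries, rescale_invSeries, rescale_invSqSeries]
  rw [← one_sub_mul_invSqSeries hp (ε * p), ← one_sub_mul_invSqSeries hp ε,
    ← one_sub_mul_invSeries hp a, ← one_sub_mul_invSeries hp b, ← one_sub_mul_invSeries hp c,
    ← one_sub_mul_invSeries hp d, ← one_add_mul_prodSeries hp (b * c),
    ← one_add_mul_prodSeries hp (b * d), ← one_add_mul_prodSeries hp (c * d)]
  simp only [map_mul C]
  ac_rfl

theorem rescale_telescoper (hp : ∀ n, IsUnit (1 - p ^ (n + 1))) (a b c d ε : R) :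
    rescale p (telescoper p a b c d ε) = C p ^ 3 *
      ((1 - C a * X) * (1 - C b * X) * (1 - C c * X) * (1 - C d * X) *
        ((1 - C ε * C p * X ^ 2) * (1 - C ε * X ^ 2)) * commonProd p a b c d ε) := by
  rw [← rescale_quadProd hp, telescoper]
  simp only [map_mul (rescale p), map_add (rescale p), rescale_C, rescale_X, map_mul C]
  ring

/-- The identity behind the telescoping, after division by `commonProd`. -/
theorem boundaryPoly_recursion {a b c d ε p x : S} (h : a * b * c * d = p ^ 2 * ε) :
    p ^ 3 * (boundaryPoly p a b c d ε x * ((1 + a * b * x) * (1 + a * c * x) * (1 + a * d * x)) -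
      (1 + a) * (boundaryPoly p (a * p) b c d (ε * p) x * ((1 - a * x) * (1 - ε * x ^ 2)))) =
    -(a * p) * (p ^ 3 * ((1 - a * x) * (1 - b * x) * (1 - c * x) * (1 - d * x) *
        ((1 - ε * p * x ^ 2) * (1 - ε * x ^ 2))) -
      x * ((1 + a * b * x) * (1 + a * c * x) * (1 + a * d * x) *
        ((p + b * c * x) * (p + b * d * x) * (p + c * d * x)))) := by
  simp only [boundaryPoly]
  grind

/-- The product over the colours, with the boundary correction. -/
noncomputable def correctedProd (p a b c d ε : R) : R⟦X⟧ :=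
  boundaryPoly (C p) (C a) (C b) (C c) (C d) (C ε) X * quadProd p a b c d ε

theorem correctedProd_rotate (p a b c d ε : R) :
    correctedProd p a b c d ε = correctedProd p b c d a ε := by
  rw [correctedProd, boundaryPoly_rotate, quadProd, colourProd_rotate, correctedProd, quadProd]

theorem correctedProd_sub (hp : ∀ n, IsUnit (1 - p ^ (n + 1))) (h : a * b * c * d = p ^ 2 * ε) :
    p ^ 3 • (correctedProd p a b c d ε - (1 + a) • correctedProd p (a * p) b c d (ε * p)) =
      -(a * p) • (rescale p (telescoper p a b c d ε) - X * telescoper p a b c d ε) := by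
  have hC : C a * C b * C c * C d = C p ^ 2 * C ε := by
    simp only [← map_mul, ← map_pow, h]
  have key := boundaryPoly_recursion (x := X) hC
  rw [rescale_telescoper hp, telescoper, correctedProd, correctedProd,
    quadProd_mul_eq_mul_commonProd hp, quadProd_eq_mul_commonProd hp]
  simp only [smul_eq_C_mul, map_add, map_mul, map_one, map_pow, map_neg]
  linear_combination commonProd p a b c d ε * key

/-- The image of `correctedProd` under the truncated functional `X ^ k ↦ p ^ (k.choose 2)`. -/
noncomputable def quadSum (B : ℕ) (p a b c d ε : R) : R := stairSum p B (correctedProd p a b c d ε)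

theorem quadSum_rotate (B : ℕ) (p a b c d ε : R) :
    quadSum B p a b c d ε = quadSum B p b c d a ε := by
  rw [quadSum, correctedProd_rotate, quadSum]

theorem pow_dvd_quadSum_sub_one_add_mul (hp : ∀ n, IsUnit (1 - p ^ (n + 1)))
    (hreg : IsLeftRegular p) (m : ℕ) (h : a * b * c * d = p ^ 2 * ε) :
    p ^ m ∣ quadSum (m + 4) p a b c d ε - (1 + a) * quadSum (m + 4) p b c d (a * p) (ε * p) := by
  have key := congrArg (stairSum p (m + 4)) (correctedProd_sub hp h)
  rw [map_smul, map_smul, map_sub, map_smul, stairSum_rescale_sub_X_mul] at key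
  simp only [smul_eq_mul] at key
  rw [← quadSum_rotate _ p (a * p), ← (hreg.pow 3).dvd_cancel_left, quadSum, quadSum, key,
    ← pow_add]
  refine ((pow_dvd_pow p ?_).mul_right _).mul_left _
  rw [Nat.choose_succ_succ' (m + 3) 1, Nat.choose_one_right]
  lia

theorem pow_dvd_quadSum_sub_one_add_mul_four (hp : ∀ n, IsUnit (1 - p ^ (n + 1)))
    (hreg : IsLeftRegular p) (m : ℕ) (h : a * b * c * d = p ^ 2 * ε) :
    p ^ m ∣ quadSum (m + 4) p a b c d ε - (1 + a) * (1 + b) * (1 + c) * (1 + d) *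
      quadSum (m + 4) p (a * p) (b * p) (c * p) (d * p) (ε * p ^ 4) := by
  have ha := pow_dvd_quadSum_sub_one_add_mul hp hreg m h
  have hb := pow_dvd_quadSum_sub_one_add_mul hp hreg m
    (a := b) (b := c) (c := d) (d := a * p) (ε := ε * p) (by linear_combination p * h)
  have hc := pow_dvd_quadSum_sub_one_add_mul hp hreg m
    (a := c) (b := d) (c := a * p) (d := b * p) (ε := ε * p * p) (by linear_combination p ^ 2 * h)
  have hd := pow_dvd_quadSum_sub_one_add_mul hp hreg m (a := d) (b := a * p) (c := b * p)
    (d := c * p) (ε := ε * p * p * p) (by linear_combination p ^ 3 * h)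
  rw [show ε * p ^ 4 = ε * p * p * p * p by ring]
  convert ((ha.add (hb.mul_left (1 + a))).add (hc.mul_left ((1 + a) * (1 + b)))).add
    (hd.mul_left ((1 + a) * (1 + b) * (1 + c))) using 1
  ring

theorem pow_dvd_quadSum_sub_prod_mul (hp : ∀ n, IsUnit (1 - p ^ (n + 1)))
    (hreg : IsLeftRegular p) (m k : ℕ) (h : a * b * c * d = p ^ 2 * ε) :
    p ^ m ∣ quadSum (m + 4) p a b c d ε - (∏ t ∈ range k,
      ((1 + a * p ^ t) * (1 + b * p ^ t) * (1 + c * p ^ t) * (1 + d * p ^ t))) *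
        quadSum (m + 4) p (a * p ^ k) (b * p ^ k) (c * p ^ k) (d * p ^ k) (ε * p ^ (4 * k)) := by
  induction k with
  | zero => simp
  | succ k ih =>
    have step := pow_dvd_quadSum_sub_one_add_mul_four hp hreg m (a := a * p ^ k) (b := b * p ^ k)
      (c := c * p ^ k) (d := d * p ^ k) (ε := ε * p ^ (4 * k))
      (by linear_combination p ^ (4 * k) * h)
    simp only [mul_assoc _ _ p, mul_assoc _ _ (p ^ 4), ← pow_succ, ← pow_add] at step
    rw [prod_range_succ, Nat.mul_succ]
    convert ih.add (step.mul_left (∏ t ∈ range k,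
      ((1 + a * p ^ t) * (1 + b * p ^ t) * (1 + c * p ^ t) * (1 + d * p ^ t)))) using 1
    ring

theorem dvd_quadSum_sub_of_dvd {π : R} (ha : π ∣ a) (hb : π ∣ b) (hc : π ∣ c) (hd : π ∣ d)
    (hε : π ∣ ε) (B : ℕ) : π ∣ quadSum (B + 1) p a b c d ε - p := by
  let φ := Ideal.Quotient.mk (Ideal.span {π})
  have hφ {x : R} (hx : π ∣ x) : φ x = 0 :=
    Ideal.Quotient.eq_zero_iff_mem.2 (Ideal.mem_span_singleton.2 hx)
  have hmap : (correctedProd p a b c d ε).map φ = C (φ p) := by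
    simp [correctedProd, boundaryPoly, quadProd, colourProd, map_prodSeries_of_eq_zero,
      map_invSeries_of_eq_zero, map_invSqSeries_of_eq_zero, hφ ha, hφ hb, hφ hc, hφ hd, hφ hε]
  have hcoeff (k : ℕ) : φ (coeff k (correctedProd p a b c d ε)) = if k = 0 then φ p else 0 := by
    rw [← coeff_map, hmap, coeff_C]
  have hsum : φ (quadSum (B + 1) p a b c d ε) = φ p := by
    rw [quadSum, stairSum_apply, map_sum, sum_range_succ']
    simp only [stairCoeff_apply, map_mul, hcoeff]
    simp
  exact Ideal.mem_span_singleton.1 (Ideal.Quotient.eq.1 hsum)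

theorem pow_dvd_quadSum_sub_prod (hp : ∀ n, IsUnit (1 - p ^ (n + 1))) (hreg : IsLeftRegular p)
    (m : ℕ) (h : a * b * c * d = p ^ 2 * ε) :
    p ^ m ∣ quadSum (m + 4) p a b c d ε - p * ∏ t ∈ range m,
      ((1 + a * p ^ t) * (1 + b * p ^ t) * (1 + c * p ^ t) * (1 + d * p ^ t)) := by
  have limit : p ^ m ∣ quadSum (m + 4) p (a * p ^ m) (b * p ^ m) (c * p ^ m) (d * p ^ m)
      (ε * p ^ (4 * m)) - p :=
    dvd_quadSum_sub_of_dvd (dvd_mul_left _ _) (dvd_mul_left _ _) (dvd_mul_left _ _)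
      (dvd_mul_left _ _) ((pow_dvd_pow p (by lia)).mul_left _) (m + 3)
  convert (pow_dvd_quadSum_sub_prod_mul hp hreg m m h).add (limit.mul_left (∏ t ∈ range m,
    ((1 + a * p ^ t) * (1 + b * p ^ t) * (1 + c * p ^ t) * (1 + d * p ^ t)))) using 1
  ring

end Quadruple

section GeneratingFunction

variable {α β ι : Type*} {w : α → ℕ} {w' : β → ℕ} {S T : Set α}

/-- The generating function of the elements of `S` by their weights `w`. A weight which is attained
infinitely often gets the junk coefficient `0`. -/
noncomputable def weightGF (w : α → ℕ) (S : Set α) : ℤ⟦X⟧ :=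
  PowerSeries.mk fun n => ((S ∩ w ⁻¹' {n}).ncard : ℤ)

theorem coeff_weightGF (n : ℕ) : coeff n (weightGF w S) = ((S ∩ w ⁻¹' {n}).ncard : ℤ) :=
  coeff_mk _ _

theorem ncard_biUnion_finset {I : Finset ι} {U : ι → Set α} (hfin : ∀ i ∈ I, (U i).Finite)
    (h : (I : Set ι).PairwiseDisjoint U) : (⋃ i ∈ I, U i).ncard = ∑ i ∈ I, (U i).ncard :=
  (I.finite_toSet.ncard_biUnion hfin h).trans (finsum_mem_coe_finset _ _)

theorem weightGF_coe_finset (I : Finset α) : weightGF w I = ∑ i ∈ I, X ^ w i := by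
  classical
  ext n
  have hfilter : (I : Set α) ∩ w ⁻¹' {n} = I.filter (fun i => n = w i) := by
    ext i
    simp [eq_comm]
  simp only [coeff_weightGF, hfilter, Set.ncard_coe_finset, map_sum, coeff_X_pow, sum_boole]

theorem weightGF_union (hw : ∀ n, (w ⁻¹' {n}).Finite) (h : Disjoint S T) :
    weightGF w (S ∪ T) = weightGF w S + weightGF w T := by
  ext n
  rw [map_add, coeff_weightGF, coeff_weightGF, coeff_weightGF, Set.union_inter_distrib_right,
    Set.ncard_union_eq (h.mono Set.inter_subset_left Set.inter_subset_left)
      ((hw n).subset Set.inter_subset_right) ((hw n).subset Set.inter_subset_right), Nat.cast_add]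

theorem coeff_weightGF_eq_sum_fiber {n : ℕ} (hw : (w ⁻¹' {n}).Finite) {I : Finset ι} {f : α → ι}
    (h : ∀ s ∈ S, w s = n → f s ∈ I) :
    coeff n (weightGF w S) = ∑ i ∈ I, coeff n (weightGF w {s ∈ S | f s = i}) := by
  have hunion : S ∩ w ⁻¹' {n} = ⋃ i ∈ I, {s ∈ S | f s = i} ∩ w ⁻¹' {n} := by
    ext s
    simp only [Set.mem_inter_iff, Set.mem_preimage, Set.mem_singleton_iff, Set.mem_iUnion,
      Set.mem_ofPred_eq, exists_prop]
    grind
  have hdisj : (I : Set ι).PairwiseDisjoint fun i => {s ∈ S | f s = i} ∩ w ⁻¹' {n} :=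
    fun i _ j _ hij => Set.disjoint_left.2 fun s hi hj => hij (hi.1.2.symm.trans hj.1.2)
  simp only [coeff_weightGF]
  rw [hunion, ncard_biUnion_finset (fun i _ => hw.subset Set.inter_subset_right) hdisj,
    Nat.cast_sum]

theorem weightGF_image {f : α → β} {m : ℕ} (hf : S.InjOn f) (hm : ∀ s ∈ S, w' (f s) = w s + m) :
    weightGF w' (f '' S) = X ^ m * weightGF w S := by
  ext n
  have himage : f '' S ∩ w' ⁻¹' {n} = f '' (S ∩ {s | w s + m = n}) := by
    rw [← Set.image_inter_preimage]
    congr 1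
    ext s
    exact and_congr_right fun hs => by simp [hm s hs]
  rw [coeff_X_pow_mul', coeff_weightGF, coeff_weightGF, himage,
    (hf.mono Set.inter_subset_left).ncard_image]
  split_ifs with h
  · congr 3
    ext s
    simp only [Set.mem_ofPred_eq, Set.mem_preimage, Set.mem_singleton_iff]
    lia
  · have hempty : S ∩ {s | w s + m = n} = ∅ := by
      ext s
      simp only [Set.mem_inter_iff, Set.mem_ofPred_eq, Set.mem_empty_iff_false]
      lia
    rw [hempty, Set.ncard_empty, Nat.cast_zero]

theorem weightGF_prod (hw : ∀ n, (w ⁻¹' {n}).Finite) (hw' : ∀ n, (w' ⁻¹' {n}).Finite)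
    (S : Set α) (T : Set β) :
    weightGF (fun z : α × β => w z.1 + w' z.2) (S ×ˢ T) = weightGF w S * weightGF w' T := by
  ext n
  have hfibre : S ×ˢ T ∩ (fun z : α × β => w z.1 + w' z.2) ⁻¹' {n} =
      ⋃ k ∈ HasAntidiagonal.antidiagonal n, (S ∩ w ⁻¹' {k.1}) ×ˢ (T ∩ w' ⁻¹' {k.2}) := by
    ext z
    simp only [Set.mem_inter_iff, Set.mem_prod, Set.mem_preimage, Set.mem_singleton_iff,
      Set.mem_iUnion, HasAntidiagonal.mem_antidiagonal, exists_prop, Prod.exists]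
    grind
  have hfin : ∀ k ∈ HasAntidiagonal.antidiagonal n,
      ((S ∩ w ⁻¹' {k.1}) ×ˢ (T ∩ w' ⁻¹' {k.2})).Finite := fun k _ =>
    ((hw _).subset Set.inter_subset_right).prod ((hw' _).subset Set.inter_subset_right)
  have hdisj : (HasAntidiagonal.antidiagonal n : Set (ℕ × ℕ)).PairwiseDisjoint
      fun k => (S ∩ w ⁻¹' {k.1}) ×ˢ (T ∩ w' ⁻¹' {k.2}) := by
    rintro k - l - hkl
    refine Set.disjoint_left.2 fun z hk hl => hkl (Prod.ext ?_ ?_)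
    · exact hk.1.2.symm.trans hl.1.2
    · exact hk.2.2.symm.trans hl.2.2
  simp only [coeff_mul, coeff_weightGF, hfibre, ncard_biUnion_finset hfin hdisj, Set.ncard_prod,
    Nat.cast_sum, Nat.cast_mul]

end GeneratingFunction

section Spaced

variable {S T : Set (Finset ℕ)} {r : ℕ → ℕ → Prop} {A : ℕ → Prop} {N : ℕ}

/-- The generating function of a family of sets of parts by the numbers they partition. -/
noncomputable abbrev partsGF (S : Set (Finset ℕ)) : ℤ⟦X⟧ := weightGF (fun s => ∑ x ∈ s, x) S

theorem finite_sum_preimage (n : ℕ) : ((fun s : Finset ℕ => ∑ x ∈ s, x) ⁻¹' {n}).Finite := by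
  refine (finite_toSet (range (n + 1)).powerset).subset fun s hs => ?_
  rw [mem_coe, mem_powerset]
  exact fun x hx => mem_range_succ_iff.2 ((single_le_sum_of_canonicallyOrdered hx).trans_eq hs)

theorem filter_union_of_forall {α : Type*} [DecidableEq α] {c : α → Prop} [DecidablePred c]
    {s t : Finset α} (hs : ∀ x ∈ s, ¬ c x) (ht : ∀ x ∈ t, c x) :
    (s ∪ t).filter (fun x => ¬ c x) = s ∧ (s ∪ t).filter c = t := by
  refine ⟨?_, ?_⟩ <;> ext x <;> grind

theorem partsGF_image2_union {c : ℕ → Prop} (hS : ∀ s ∈ S, ∀ x ∈ s, ¬ c x)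
    (hT : ∀ t ∈ T, ∀ x ∈ t, c x) :
    partsGF (Set.image2 (· ∪ ·) S T) = partsGF S * partsGF T := by
  classical
  have hinj : (S ×ˢ T).InjOn fun z => z.1 ∪ z.2 := fun z hz z' hz' h => by
    obtain ⟨hl, hr⟩ := filter_union_of_forall (hS _ hz.1) (hT _ hz.2)
    obtain ⟨hl', hr'⟩ := filter_union_of_forall (hS _ hz'.1) (hT _ hz'.2)
    exact Prod.ext (hl.symm.trans ((congrArg _ h).trans hl'))
      (hr.symm.trans ((congrArg _ h).trans hr'))
  have hsum : ∀ z ∈ S ×ˢ T, ∑ x ∈ z.1 ∪ z.2, x = (∑ x ∈ z.1, x + ∑ x ∈ z.2, x) + 0 :=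
    fun z hz => sum_union (disjoint_left.2 fun x hx hx' => hS _ hz.1 x hx (hT _ hz.2 x hx'))
  rw [← Set.image_prod, partsGF, weightGF_image hinj hsum, pow_zero, one_mul,
    weightGF_prod finite_sum_preimage finite_sum_preimage]

theorem partsGF_powerset (I : Finset ℕ) : partsGF I.powerset = ∏ x ∈ I, (1 + X ^ x) := by
  rw [partsGF, weightGF_coe_finset, prod_one_add]
  exact sum_congr rfl fun s _ => (prod_pow_eq_pow_sum s _ X).symm

/-- The sets of `k` numbers `≥ m` with the property `A`, any two elements `x < y` of which are in
the relation `r`. -/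
def spaced (r : ℕ → ℕ → Prop) (A : ℕ → Prop) (m k : ℕ) : Set (Finset ℕ) :=
  {u | #u = k ∧ (∀ x ∈ u, ∀ y ∈ u, x < y → r x y) ∧ ∀ x ∈ u, m ≤ x ∧ A x}

theorem spaced_congr {A' : ℕ → Prop} {m m' : ℕ} (h : ∀ x, m ≤ x ∧ A x ↔ m' ≤ x ∧ A' x) (k : ℕ) :
    spaced r A m k = spaced r A' m' k := by
  simp only [spaced, h]

theorem partsGF_spaced_zero (m : ℕ) : partsGF (spaced r A m 0) = 1 := by
  have hempty : spaced r A m 0 = ({∅} : Finset (Finset ℕ)) := by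
    ext u
    simp only [spaced, Set.mem_ofPred_eq, card_eq_zero, mem_coe, mem_singleton]
    exact ⟨And.left, by rintro rfl; simp⟩
  rw [hempty, partsGF, weightGF_coe_finset, sum_singleton, sum_empty, pow_zero]

theorem spaced_succ {m m' : ℕ} (hA : A m) (hm : m < m')
    (hr : ∀ y, A y → m < y → (r m y ↔ m' ≤ y)) (k : ℕ) :
    spaced r A m (k + 1) = spaced r A (m + 1) (k + 1) ∪ insert m '' spaced r A m' k := by
  ext u
  constructor
  · rintro ⟨hcard, hgap, hmem⟩
    by_cases hu : m ∈ u
    · refine .inr ⟨u.erase m, ⟨by rw [card_erase_of_mem hu, hcard, Nat.add_sub_cancel],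
        fun x hx y hy => hgap x (mem_of_mem_erase hx) y (mem_of_mem_erase hy), fun x hx => ?_⟩,
        insert_erase hu⟩
      obtain ⟨hne, hx⟩ := mem_erase.1 hx
      have hlt : m < x := (hmem x hx).1.lt_of_ne' hne
      exact ⟨(hr x (hmem x hx).2 hlt).1 (hgap m hu x hx hlt), (hmem x hx).2⟩
    · exact .inl ⟨hcard, hgap, fun x hx =>
        ⟨(hmem x hx).1.lt_of_ne (ne_of_mem_of_not_mem hx hu).symm, (hmem x hx).2⟩⟩
  · rintro (⟨hcard, hgap, hmem⟩ | ⟨u, ⟨hcard, hgap, hmem⟩, rfl⟩)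
    · exact ⟨hcard, hgap, fun x hx => ⟨(Nat.le_succ m).trans (hmem x hx).1, (hmem x hx).2⟩⟩
    · have hnot : m ∉ u := fun h => (hmem m h).1.not_gt hm
      refine ⟨by rw [card_insert_of_notMem hnot, hcard], ?_, ?_⟩
      · simp only [mem_insert]
        rintro x (rfl | hx) y (rfl | hy) hxy
        · exact (hxy.false).elim
        · exact (hr y (hmem y hy).2 hxy).2 (hmem y hy).1
        · exact absurd (hm.trans_le (hmem x hx).1) hxy.not_gt
        · exact hgap x hx y hy hxy
      · simp only [mem_insert, forall_eq_or_imp]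
        exact ⟨⟨le_rfl, hA⟩, fun x hx => ⟨hm.le.trans (hmem x hx).1, (hmem x hx).2⟩⟩

theorem partsGF_spaced_succ {m m' : ℕ} (hA : A m) (hm : m < m')
    (hr : ∀ y, A y → m < y → (r m y ↔ m' ≤ y)) (k : ℕ) :
    partsGF (spaced r A m (k + 1)) =
      partsGF (spaced r A (m + 1) (k + 1)) + X ^ m * partsGF (spaced r A m' k) := by
  have hnot : ∀ u ∈ spaced r A m' k, m ∉ u := fun u hu h => (hu.2.2 m h).1.not_gt hm
  have hdisj : Disjoint (spaced r A (m + 1) (k + 1)) (insert m '' spaced r A m' k) := by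
    refine Set.disjoint_left.2 ?_
    rintro _ ⟨-, -, hmem⟩ ⟨u, -, rfl⟩
    exact (hmem m (mem_insert_self m u)).1.not_gt m.lt_succ_self
  have hinj : (spaced r A m' k).InjOn (insert m) := fun u hu v hv h => by
    rw [← erase_insert (hnot u hu), h, erase_insert (hnot v hv)]
  have hsum : ∀ u ∈ spaced r A m' k, ∑ x ∈ insert m u, x = ∑ x ∈ u, x + m :=
    fun u hu => (sum_insert (hnot u hu)).trans (add_comm _ _)
  rw [spaced_succ hA hm hr, partsGF, weightGF_union finite_sum_preimage hdisj,
    weightGF_image hinj hsum]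

theorem spaced_add (hr : ∀ x y, r (x + N) (y + N) ↔ r x y) (hA : ∀ x, A (x + N) ↔ A x)
    (m k : ℕ) : spaced r A (m + N) k = image (· + N) '' spaced r A m k := by
  ext u
  constructor
  · rintro ⟨hcard, hgap, hmem⟩
    have hsub : (u : Set ℕ) ⊆ (· + N) '' {x | m ≤ x ∧ A x} := fun x hx => by
      obtain ⟨hle, hx⟩ := hmem x hx
      obtain ⟨y, rfl⟩ := Nat.exists_eq_add_of_le' (le_of_add_le_right hle)
      exact ⟨y, ⟨Nat.le_of_add_le_add_right hle, (hA y).1 hx⟩, rfl⟩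
    obtain ⟨v, hv, rfl⟩ := subset_set_image_iff.1 hsub
    exact ⟨v, ⟨by rw [← hcard, card_image_of_injective _ (add_left_injective N)],
      fun x hx y hy hxy => (hr x y).1 (hgap _ (mem_image_of_mem _ hx) _ (mem_image_of_mem _ hy)
        (Nat.add_lt_add_right hxy N)), hv⟩, rfl⟩
  · rintro ⟨v, ⟨hcard, hgap, hmem⟩, rfl⟩
    refine ⟨by rw [card_image_of_injective _ (add_left_injective N), hcard], ?_, ?_⟩
    · simp only [forall_mem_image]
      exact fun x hx y hy hxy => (hr x y).2 (hgap x hx y hy (Nat.lt_of_add_lt_add_right hxy))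
    · simp only [forall_mem_image]
      exact fun x hx => ⟨Nat.add_le_add_right (hmem x hx).1 N, (hA x).2 (hmem x hx).2⟩

theorem partsGF_spaced_add (hr : ∀ x y, r (x + N) (y + N) ↔ r x y)
    (hA : ∀ x, A (x + N) ↔ A x) (m k : ℕ) :
    partsGF (spaced r A (m + N) k) = (X ^ N) ^ k * partsGF (spaced r A m k) := by
  have hinj : Function.Injective (image (· + N)) := image_injective (add_left_injective N)
  have hsum : ∀ u ∈ spaced r A m k, ∑ x ∈ u.image (· + N), x = ∑ x ∈ u, x + N * k := by
    rintro u ⟨hcard, -⟩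
    rw [sum_image (add_left_injective N).injOn, sum_add_distrib, sum_const, hcard, smul_eq_mul,
      mul_comm]
  rw [spaced_add hr hA, partsGF, weightGF_image hinj.injOn hsum, pow_mul]

end Spaced

section Staircase

variable {N : ℕ} {P S : ℕ → Prop}

theorem isUnit_one_sub_X_pow_pow (hN : 0 < N) (n : ℕ) :
    IsUnit (1 - ((X : ℤ⟦X⟧) ^ N) ^ (n + 1)) := by
  rw [isUnit_iff_constantCoeff]
  simp [hN.ne']

theorem partsGF_spaced_dvd (hN : 0 < N) {d : ℕ} (hd : 0 < d) (k l : ℕ) :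
    partsGF (spaced (fun x y => x + N * d ≤ y) (N ∣ ·) (N * l) k) =
      (X ^ N) ^ (l * k + d * k.choose 2) * invPochhammer (X ^ N) k := by
  induction k generalizing l with
  | zero => simp [partsGF_spaced_zero, invPochhammer_zero]
  | succ k ih =>
    have hnext (x : ℕ) : N * l + 1 ≤ x ∧ N ∣ x ↔ N * l + N ≤ x ∧ N ∣ x := by
      refine and_congr_left ?_
      rintro ⟨z, rfl⟩
      rw [← Nat.mul_succ, Nat.succ_le_iff, Nat.mul_lt_mul_left hN, Nat.mul_le_mul_left_iff hN,
        Nat.succ_le_iff]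
    have hsucc := partsGF_spaced_succ (r := fun x y => x + N * d ≤ y) (A := (N ∣ ·))
      (dvd_mul_right N l) (Nat.mul_lt_mul_of_pos_left (Nat.lt_add_of_pos_right hd) hN)
      (fun _ _ _ => by rw [mul_add]) k
    rw [ih, spaced_congr hnext, partsGF_spaced_add (fun x y => by lia) (fun x => by simp)] at hsucc
    refine (isUnit_one_sub_X_pow_pow hN k).mul_left_cancel ?_
    rw [mul_left_comm, one_sub_pow_mul_invPochhammer (isUnit_one_sub_X_pow_pow hN k),
      Nat.choose_succ_succ' k 1, Nat.choose_one_right]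
    linear_combination hsucc

/-- The relation between parts `x < y` of a two-type partition: they differ by at least `N`, with
equality only if `x` is repeatable, that is, has the property `P`. -/
def gapRel (N : ℕ) (P : ℕ → Prop) (x y : ℕ) : Prop := x + N ≤ y ∧ (y = x + N → P x)

theorem gapRel_add (hP : ∀ x, P (x + N) ↔ P x) (x y : ℕ) :
    gapRel N P (x + N) (y + N) ↔ gapRel N P x y := by
  rw [gapRel, gapRel, hP, Nat.add_le_add_iff_right, Nat.add_right_cancel_iff]

theorem partsGF_spaced_gapRel_add (hP : ∀ x, P (x + N) ↔ P x) (hS : ∀ x, S (x + N) ↔ S x)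
    (m k : ℕ) : partsGF (spaced (gapRel N P) (fun x => P x ∨ S x) (m + N) k) =
      (X ^ N) ^ k * partsGF (spaced (gapRel N P) (fun x => P x ∨ S x) m k) :=
  partsGF_spaced_add (gapRel_add hP) (fun x => by rw [hP, hS]) m k

theorem partsGF_spaced_succ_of_repeatable {A : ℕ → Prop} (hN : 0 < N) {m : ℕ} (hA : A m)
    (hm : P m) (k : ℕ) : partsGF (spaced (gapRel N P) A m (k + 1)) =
      partsGF (spaced (gapRel N P) A (m + 1) (k + 1)) +
        X ^ m * partsGF (spaced (gapRel N P) A (m + N) k) :=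
  partsGF_spaced_succ hA (Nat.lt_add_of_pos_right hN)
    (fun _ _ _ => ⟨And.left, fun h => ⟨h, fun _ => hm⟩⟩) k

theorem partsGF_spaced_succ_of_not_repeatable {A : ℕ → Prop} {m : ℕ} (hA : A m) (hm : ¬ P m)
    (k : ℕ) : partsGF (spaced (gapRel N P) A m (k + 1)) =
      partsGF (spaced (gapRel N P) A (m + 1) (k + 1)) +
        X ^ m * partsGF (spaced (gapRel N P) A (m + 1 + N) k) := by
  refine partsGF_spaced_succ hA (by lia) (fun y _ _ => ?_) k
  rw [gapRel]
  grind

theorem spaced_succ_of_not {r : ℕ → ℕ → Prop} {A : ℕ → Prop} {m : ℕ} (hA : ¬ A m) (k : ℕ) :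
    spaced r A m k = spaced r A (m + 1) k :=
  spaced_congr (fun x => by grind) k

variable [DecidablePred P] [DecidablePred S]

/-- The contribution to the infinite product of the parts congruent to `x` modulo `N` and not less
than `x`, after the staircase has been removed. -/
noncomputable def colourFactor (N : ℕ) (P S : ℕ → Prop) [DecidablePred P] [DecidablePred S]
    (x : ℕ) : ℤ⟦X⟧⟦X⟧ :=
  if P x then invSeries (X ^ N) (X ^ x) else if S x then prodSeries (X ^ N) (X ^ x) else 1

/-- The infinite product over the repeatable and the non-repeatable parts not less than `m`. -/
noncomputable def tailSeries (N : ℕ) (P S : ℕ → Prop) [DecidablePred P] [DecidablePred S]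
    (m : ℕ) : ℤ⟦X⟧⟦X⟧ := ∏ x ∈ Ico m (m + N), colourFactor N P S x

theorem colourFactor_add (hP : ∀ x, P (x + N) ↔ P x) (hS : ∀ x, S (x + N) ↔ S x) (x : ℕ) :
    colourFactor N P S (x + N) = rescale (X ^ N) (colourFactor N P S x) := by
  simp only [colourFactor, hP, hS, apply_ite (rescale ((X : ℤ⟦X⟧) ^ N)), rescale_invSeries,
    rescale_prodSeries, map_one, pow_add]

theorem tailSeries_add (hP : ∀ x, P (x + N) ↔ P x) (hS : ∀ x, S (x + N) ↔ S x) (m : ℕ) :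
    tailSeries N P S (m + N) = rescale (X ^ N) (tailSeries N P S m) := by
  rw [tailSeries, tailSeries, map_prod, ← prod_Ico_add']
  exact prod_congr rfl fun x _ => colourFactor_add hP hS x

theorem constantCoeff_tailSeries (m : ℕ) : constantCoeff (tailSeries N P S m) = 1 := by
  rw [tailSeries, map_prod]
  refine prod_eq_one fun x _ => ?_
  rw [colourFactor]
  split_ifs
  · exact constantCoeff_invSeries _ _
  · exact constantCoeff_prodSeries _ _
  · exact map_one _

theorem colourFactor_add_of_repeatable (hN : 0 < N) (hP : ∀ x, P (x + N) ↔ P x) {x : ℕ}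
    (hx : P x) : colourFactor N P S (x + N) = (1 - C (X ^ x) * X) * colourFactor N P S x := by
  rw [colourFactor, if_pos ((hP x).2 hx), colourFactor, if_pos hx, pow_add,
    one_sub_mul_invSeries (isUnit_one_sub_X_pow_pow hN)]

theorem colourFactor_of_not_repeatable (hN : 0 < N) (hP : ∀ x, P (x + N) ↔ P x)
    (hS : ∀ x, S (x + N) ↔ S x) {x : ℕ} (hx : ¬ P x) (hx' : S x) :
    colourFactor N P S x = (1 + C (X ^ x) * X) * colourFactor N P S (x + N) := by
  rw [colourFactor, if_neg hx, if_pos hx', colourFactor, if_neg (mt (hP x).1 hx),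
    if_pos ((hS x).2 hx'), pow_add, one_add_mul_prodSeries (isUnit_one_sub_X_pow_pow hN)]

theorem colourFactor_of_not_allowed {x : ℕ} (hx : ¬ (P x ∨ S x)) : colourFactor N P S x = 1 := by
  obtain ⟨hPx, hSx⟩ := not_or.1 hx
  rw [colourFactor, if_neg hPx, if_neg hSx]

theorem exists_tailSeries_eq_mul (hN : 0 < N) (m : ℕ) : ∃ F,
    tailSeries N P S m = colourFactor N P S m * F ∧
      tailSeries N P S (m + 1) = colourFactor N P S (m + N) * F := by
  refine ⟨∏ x ∈ Ico (m + 1) (m + N), colourFactor N P S x, ?_, ?_⟩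
  · exact prod_eq_prod_Ico_succ_bot (Nat.lt_add_of_pos_right hN) _
  · rw [tailSeries, add_right_comm, prod_Ico_succ_top (by lia), mul_comm]

theorem tailSeries_of_repeatable (hN : 0 < N) (hP : ∀ x, P (x + N) ↔ P x) {m : ℕ} (hm : P m) :
    tailSeries N P S m =
      tailSeries N P S (m + 1) + C (X ^ m) * (X * tailSeries N P S m) := by
  obtain ⟨F, hF, hF'⟩ := exists_tailSeries_eq_mul (P := P) (S := S) hN m
  rw [hF', hF, colourFactor_add_of_repeatable hN hP hm]
  ring

theorem tailSeries_of_not_repeatable (hN : 0 < N) (hP : ∀ x, P (x + N) ↔ P x)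
    (hS : ∀ x, S (x + N) ↔ S x) {m : ℕ} (hm : ¬ P m) (hm' : S m) :
    tailSeries N P S m =
      tailSeries N P S (m + 1) + C (X ^ m) * (X * tailSeries N P S (m + 1)) := by
  obtain ⟨F, hF, hF'⟩ := exists_tailSeries_eq_mul (P := P) (S := S) hN m
  rw [hF, hF', colourFactor_of_not_repeatable hN hP hS hm hm']
  ring

theorem tailSeries_of_not_allowed (hN : 0 < N) (hP : ∀ x, P (x + N) ↔ P x)
    (hS : ∀ x, S (x + N) ↔ S x) {m : ℕ} (hm : ¬ (P m ∨ S m)) :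
    tailSeries N P S m = tailSeries N P S (m + 1) := by
  obtain ⟨F, hF, hF'⟩ := exists_tailSeries_eq_mul (P := P) (S := S) hN m
  rw [hF, hF', colourFactor_of_not_allowed hm, colourFactor_of_not_allowed (by rwa [hP, hS])]

/-- Removing the staircase `0, N, 2N, …` from the parts of a two-type partition leaves parts which
may be repeated if they have the property `P` and have to be distinct otherwise. -/
theorem partsGF_spaced_gapRel (hN : 0 < N) (hP : ∀ x, P (x + N) ↔ P x)
    (hS : ∀ x, S (x + N) ↔ S x) (m k : ℕ) :
    partsGF (spaced (gapRel N P) (fun x => P x ∨ S x) m k) =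
      stairCoeff (X ^ N) k (tailSeries N P S m) := by
  induction k generalizing m with
  | zero => rw [partsGF_spaced_zero, stairCoeff_zero, constantCoeff_tailSeries]
  | succ k ih =>
    let D (m : ℕ) := partsGF (spaced (gapRel N P) (fun x => P x ∨ S x) m (k + 1)) -
      stairCoeff (X ^ N) (k + 1) (tailSeries N P S m)
    have const_succ (m : ℕ) : D m = D (m + 1) := by
      by_cases hm : P m
      · have hG := partsGF_spaced_succ_of_repeatable (A := fun x => P x ∨ S x) hN (.inl hm) hm k
        have hT := congrArg (stairCoeff (X ^ N) (k + 1))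
          (tailSeries_of_repeatable (S := S) hN hP hm)
        rw [partsGF_spaced_gapRel_add hP hS] at hG
        rw [map_add, stairCoeff_C_mul_X_mul, ← ih] at hT
        linear_combination hG - hT
      by_cases hm' : S m
      · have hG := partsGF_spaced_succ_of_not_repeatable (N := N) (A := fun x => P x ∨ S x)
          (.inr hm') hm k
        have hT := congrArg (stairCoeff (X ^ N) (k + 1))
          (tailSeries_of_not_repeatable hN hP hS hm hm')
        rw [partsGF_spaced_gapRel_add hP hS] at hG
        rw [map_add, stairCoeff_C_mul_X_mul, ← ih] at hT
        linear_combination hG - hT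
      · have hnot : ¬ (P m ∨ S m) := not_or.2 ⟨hm, hm'⟩
        simp only [D]
        rw [tailSeries_of_not_allowed hN hP hS hnot, spaced_succ_of_not hnot]
    have const_add (n : ℕ) : D m = D (m + n) := by
      induction n with
      | zero => rfl
      | succ n ihn => rw [ihn, const_succ, add_assoc]
    have scale : D (m + N) = (X ^ N) ^ (k + 1) * D m := by
      simp only [D]
      rw [partsGF_spaced_gapRel_add hP hS, tailSeries_add hP hS, stairCoeff_rescale, mul_sub]
    refine sub_eq_zero.1 ((isUnit_one_sub_X_pow_pow hN k).mul_right_eq_zero.1 ?_)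
    change _ * D m = 0
    rw [sub_mul, one_mul, ← scale, ← const_add, sub_self]

/-- The series for two-type partitions into parts `≥ m` whose non-repeatable parts are `≥ N`. -/
noncomputable def boundarySeries (N : ℕ) (P S : ℕ → Prop) [DecidablePred P] [DecidablePred S]
    (m : ℕ) : ℤ⟦X⟧⟦X⟧ :=
  tailSeries N P S N + ∑ x ∈ Ico m N with P x, C (X ^ x) * (X * tailSeries N P S x)

theorem boundarySeries_of_repeatable {m : ℕ} (hm : m < N) (h : P m) :
    boundarySeries N P S m =
      boundarySeries N P S (m + 1) + C (X ^ m) * (X * tailSeries N P S m) := by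
  rw [boundarySeries, boundarySeries, sum_filter, sum_filter, sum_eq_sum_Ico_succ_bot hm, if_pos h]
  ring

theorem boundarySeries_of_not_repeatable {m : ℕ} (hm : m < N) (h : ¬ P m) :
    boundarySeries N P S m = boundarySeries N P S (m + 1) := by
  rw [boundarySeries, boundarySeries, sum_filter, sum_filter, sum_eq_sum_Ico_succ_bot hm,
    if_neg h, zero_add]

theorem constantCoeff_boundarySeries (m : ℕ) : constantCoeff (boundarySeries N P S m) = 1 := by
  simp [boundarySeries, constantCoeff_tailSeries]

theorem partsGF_spaced_gapRel_of_large (hN : 0 < N) (hP : ∀ x, P (x + N) ↔ P x)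
    (hS : ∀ x, S (x + N) ↔ S x) {m : ℕ} (hm : m ≤ N) (k : ℕ) :
    partsGF (spaced (gapRel N P) (fun x => P x ∨ S x ∧ N ≤ x) m k) =
      stairCoeff (X ^ N) k (boundarySeries N P S m) := by
  have hlarge (n : ℕ) (hn : N ≤ n) (k : ℕ) :
      spaced (gapRel N P) (fun x => P x ∨ S x ∧ N ≤ x) n k =
        spaced (gapRel N P) (fun x => P x ∨ S x) n k :=
    spaced_congr (fun x => by grind) k
  rcases k with _ | k
  · rw [partsGF_spaced_zero, stairCoeff_zero, constantCoeff_boundarySeries]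
  induction hm using Nat.decreasingInduction with
  | self =>
    rw [hlarge N le_rfl, partsGF_spaced_gapRel hN hP hS, boundarySeries, Ico_self, filter_empty,
      sum_empty, add_zero]
  | of_succ m hm ih =>
    by_cases h : P m
    · rw [partsGF_spaced_succ_of_repeatable hN (.inl h) h, ih, hlarge (m + N) le_add_self,
        partsGF_spaced_gapRel_add hP hS, partsGF_spaced_gapRel hN hP hS,
        boundarySeries_of_repeatable hm h, map_add, stairCoeff_C_mul_X_mul]
    · rw [spaced_succ_of_not (by grind), ih, boundarySeries_of_not_repeatable hm h]

end Staircase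

section ModFifteen

/-- `m` lies in one of the classes `3, 5, 6, 9, 10, 12` modulo `15`: these are the sums of two
different classes among `-2^3, -2^2, -2^1, -2^0`. -/
def IsPairClass (m : ℕ) : Prop := ¬ 15 ∣ m ∧ ¬ IsPosPowClass m ∧ ¬ IsNegPowClass m

instance : DecidablePred IsPairClass := fun m =>
  inferInstanceAs (Decidable (¬ 15 ∣ m ∧ ¬ IsPosPowClass m ∧ ¬ IsNegPowClass m))

theorem isNegPowClass_iff (m : ℕ) :
    IsNegPowClass m ↔ m % 15 = 7 ∨ m % 15 = 11 ∨ m % 15 = 13 ∨ m % 15 = 14 := by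
  simp only [IsNegPowClass, Int.ModEq]
  lia

theorem isPosPowClass_iff (m : ℕ) :
    IsPosPowClass m ↔ m % 15 = 1 ∨ m % 15 = 2 ∨ m % 15 = 4 ∨ m % 15 = 8 := by
  simp only [IsPosPowClass, Int.ModEq]
  lia

theorem isNegPowClass_add_fifteen (m : ℕ) : IsNegPowClass (m + 15) ↔ IsNegPowClass m := by
  simp only [isNegPowClass_iff, Nat.add_mod_right]

theorem isPairClass_add_fifteen (m : ℕ) : IsPairClass (m + 15) ↔ IsPairClass m := by
  simp only [IsPairClass, isPosPowClass_iff, isNegPowClass_add_fifteen, Nat.add_mod_right,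
    Nat.dvd_add_self_right]

/-- The infinite product over the parts congruent to the classes `7, 11, 13, 14` modulo `15`, and
over those congruent to a sum of two of these and not less than it. -/
noncomputable def baseProd : ℤ⟦X⟧⟦X⟧ :=
  colourProd (X ^ 15) (X ^ 7) (X ^ 11) (X ^ 13) (X ^ 14)

local notation "T" => tailSeries 15 IsNegPowClass IsPairClass

local notation "κ" => colourFactor 15 IsNegPowClass IsPairClass

theorem baseProd_eq : baseProd =
    κ 18 * κ 20 * κ 21 * κ 24 * κ 25 * κ 27 * (κ 7 * κ 11 * κ 13 * κ 14) := by
  have hinv {x : ℕ} (hx : IsNegPowClass x) : κ x = invSeries (X ^ 15) (X ^ x) := if_pos hx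
  have hprod {x : ℕ} (hx : IsPairClass x) : κ x = prodSeries (X ^ 15) (X ^ x) :=
    (if_neg hx.2.2).trans (if_pos hx)
  simp (disch := decide) only [hinv, hprod, baseProd, colourProd, ← pow_add, Nat.reduceAdd]

theorem colourFactor_add_fifteen {x : ℕ} (hx : IsNegPowClass x) :
    κ (x + 15) = (1 - C X ^ x * X) * κ x := by
  rw [← map_pow]
  exact colourFactor_add_of_repeatable (by lia) isNegPowClass_add_fifteen hx

theorem colourFactor_of_isPairClass {x : ℕ} (hx : IsPairClass x) :
    κ x = (1 + C X ^ x * X) * κ (x + 15) := by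
  rw [← map_pow]
  exact colourFactor_of_not_repeatable (by lia) isNegPowClass_add_fifteen
    isPairClass_add_fifteen hx.2.2 hx

theorem tailSeries_seven : T 7 =
    (1 + C X ^ 9 * X) * (1 + C X ^ 10 * X) * (1 + C X ^ 12 * X) * baseProd := by
  have h9 := colourFactor_of_isPairClass (x := 9) (by decide)
  have h10 := colourFactor_of_isPairClass (x := 10) (by decide)
  have h12 := colourFactor_of_isPairClass (x := 12) (by decide)
  rw [tailSeries, prod_Ico_eq_prod_range, baseProd_eq]
  simp (disch := decide) only [Nat.reduceAdd, Nat.reduceSub, prod_range_succ, prod_range_zero,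
    colourFactor_of_not_allowed, h9, h10, h12]
  ring

theorem tailSeries_eleven : T 11 = (1 - C X ^ 7 * X) * (1 + C X ^ 12 * X) * baseProd := by
  have h7 := colourFactor_add_fifteen (x := 7) (by decide)
  have h12 := colourFactor_of_isPairClass (x := 12) (by decide)
  rw [tailSeries, prod_Ico_eq_prod_range, baseProd_eq]
  simp (disch := decide) only [Nat.reduceAdd, Nat.reduceSub, prod_range_succ, prod_range_zero,
    colourFactor_of_not_allowed, h7, h12]
  ring

theorem tailSeries_thirteen : T 13 = (1 - C X ^ 7 * X) * (1 - C X ^ 11 * X) * baseProd := by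
  have h7 := colourFactor_add_fifteen (x := 7) (by decide)
  have h11 := colourFactor_add_fifteen (x := 11) (by decide)
  rw [tailSeries, prod_Ico_eq_prod_range, baseProd_eq]
  simp (disch := decide) only [Nat.reduceAdd, Nat.reduceSub, prod_range_succ, prod_range_zero,
    colourFactor_of_not_allowed, h7, h11]
  ring

theorem tailSeries_fourteen : T 14 =
    (1 - C X ^ 7 * X) * (1 - C X ^ 11 * X) * (1 - C X ^ 13 * X) * baseProd := by
  have h7 := colourFactor_add_fifteen (x := 7) (by decide)
  have h11 := colourFactor_add_fifteen (x := 11) (by decide)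
  have h13 := colourFactor_add_fifteen (x := 13) (by decide)
  rw [tailSeries, prod_Ico_eq_prod_range, baseProd_eq]
  simp (disch := decide) only [Nat.reduceAdd, Nat.reduceSub, prod_range_succ, prod_range_zero,
    colourFactor_of_not_allowed, h7, h11, h13]
  ring

theorem tailSeries_fifteen : T 15 =
    (1 - C X ^ 7 * X) * (1 - C X ^ 11 * X) * (1 - C X ^ 13 * X) * (1 - C X ^ 14 * X) *
      baseProd := by
  have h7 := colourFactor_add_fifteen (x := 7) (by decide)
  have h11 := colourFactor_add_fifteen (x := 11) (by decide)
  have h13 := colourFactor_add_fifteen (x := 13) (by decide)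
  have h14 := colourFactor_add_fifteen (x := 14) (by decide)
  rw [tailSeries, prod_Ico_eq_prod_range, baseProd_eq]
  simp (disch := decide) only [Nat.reduceAdd, Nat.reduceSub, prod_range_succ, prod_range_zero,
    colourFactor_of_not_allowed, h7, h11, h13, h14]
  ring

/-- The series of the sets of parts that are not multiples of `15` and contain `7`. -/
noncomputable def sevenSeries : ℤ⟦X⟧⟦X⟧ := C (X ^ 7) * (X * T 7)

/-- The series of the sets of parts that are not multiples of `15` and do not contain `7`. -/
noncomputable def noSevenSeries : ℤ⟦X⟧⟦X⟧ := boundarySeries 15 IsNegPowClass IsPairClass 8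

theorem noSevenSeries_eq : noSevenSeries =
    T 15 + C X ^ 11 * (X * T 11) + C X ^ 13 * (X * T 13) + C X ^ 14 * (X * T 14) := by
  have hfilter : {x ∈ Ico 8 15 | IsNegPowClass x} = {11, 13, 14} := by decide
  simp [noSevenSeries, boundarySeries, hfilter, add_assoc]

theorem boundarySeries_zero : boundarySeries 15 IsNegPowClass IsPairClass 0 =
    noSevenSeries + sevenSeries := by
  have hfilter : {x ∈ Ico 0 15 | IsNegPowClass x} =
      insert 7 {x ∈ Ico 8 15 | IsNegPowClass x} := by decide
  rw [boundarySeries, hfilter, sum_insert (by decide), noSevenSeries, boundarySeries, sevenSeries]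
  ring

/-- The series which the functional `X ^ k ↦ X ^ (15 * k.choose 2)` takes to the generating function
of `GThree`. A multiple of `15` counts as two parts, hence the squares in `invSqSeries`. -/
noncomputable def gapSeries : ℤ⟦X⟧⟦X⟧ :=
  sevenSeries * invSqSeries (X ^ 15) (X ^ 15) +
    noSevenSeries * invSqSeries (X ^ 15) ((X ^ 15) ^ 2)

theorem C_mul_gapSeries : C (X ^ 15) * gapSeries =
    correctedProd (X ^ 15) (X ^ 7) (X ^ 11) (X ^ 13) (X ^ 14) (X ^ 15) := by
  rw [gapSeries, correctedProd, quadProd, ← baseProd, sq (X ^ 15),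
    ← one_sub_mul_invSqSeries (isUnit_one_sub_X_pow_pow (by lia)), sevenSeries, noSevenSeries_eq,
    tailSeries_seven, tailSeries_eleven, tailSeries_thirteen, tailSeries_fourteen,
    tailSeries_fifteen, boundaryPoly]
  simp only [map_pow]
  ring

end ModFifteen

section PartsModFifteen

/-- The sets of `k` parts `≥ m` which satisfy the conditions on the parts that are not multiples
of `15`. -/
def nonMultSets (m k : ℕ) : Set (Finset ℕ) :=
  spaced (gapRel 15 IsNegPowClass) (fun x => IsNegPowClass x ∨ IsPairClass x ∧ 15 ≤ x) m k

/-- The sets of `j / 2` multiples of `15`, each of them `≥ 15 * l`, with differences at least `60`.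
They are indexed by `j` because a multiple of `15` counts as two parts. -/
def multSets (l j : ℕ) : Set (Finset ℕ) :=
  {v | 2 * #v = j ∧ v ∈ spaced (fun x y => x + 15 * 4 ≤ y) (15 ∣ ·) (15 * l) #v}

theorem not_dvd_of_mem_nonMultSets {m k : ℕ} {u : Finset ℕ} (hu : u ∈ nonMultSets m k) :
    ∀ x ∈ u, ¬ 15 ∣ x := by
  intro x hx
  rcases (hu.2.2 x hx).2 with h | h
  · rw [isNegPowClass_iff] at h
    lia
  · exact h.1.1

theorem dvd_of_mem_multSets {l j : ℕ} {v : Finset ℕ} (hv : v ∈ multSets l j) : ∀ x ∈ v, 15 ∣ x :=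
  fun x hx => (hv.2.2.2 x hx).2

theorem partsGF_nonMultSets {m : ℕ} (hm : m ≤ 15) (k : ℕ) : partsGF (nonMultSets m k) =
    stairCoeff (X ^ 15) k (boundarySeries 15 IsNegPowClass IsPairClass m) :=
  partsGF_spaced_gapRel_of_large (by lia) isNegPowClass_add_fifteen isPairClass_add_fifteen hm k

theorem nonMultSets_eight (k : ℕ) : nonMultSets 8 k = {u ∈ nonMultSets 0 k | 7 ∉ u} := by
  have hiff (x : ℕ) (hx : IsNegPowClass x ∨ IsPairClass x ∧ 15 ≤ x) : 8 ≤ x ↔ x ≠ 7 := by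
    rw [isNegPowClass_iff] at hx
    lia
  ext u
  constructor
  · rintro ⟨hcard, hgap, hmem⟩
    exact ⟨⟨hcard, hgap, fun x hx => ⟨x.zero_le, (hmem x hx).2⟩⟩,
      fun h => by simpa using (hmem 7 h).1⟩
  · rintro ⟨⟨hcard, hgap, hmem⟩, h⟩
    exact ⟨hcard, hgap, fun x hx =>
      ⟨(hiff x (hmem x hx).2).2 (ne_of_mem_of_not_mem hx h), (hmem x hx).2⟩⟩

theorem partsGF_nonMultSets_seven_mem (k : ℕ) : partsGF {u ∈ nonMultSets 0 k | 7 ∈ u} =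
    stairCoeff (X ^ 15) k sevenSeries := by
  have hunion : nonMultSets 0 k = {u ∈ nonMultSets 0 k | 7 ∈ u} ∪ nonMultSets 8 k := by
    rw [nonMultSets_eight]
    ext u
    simp only [Set.mem_union, Set.mem_ofPred_eq]
    tauto
  have hdisj : Disjoint {u ∈ nonMultSets 0 k | 7 ∈ u} (nonMultSets 8 k) := by
    rw [nonMultSets_eight]
    exact Set.disjoint_left.2 fun u hu hu' => hu'.2 hu.2
  have hsum : partsGF (nonMultSets 0 k) =
      partsGF {u ∈ nonMultSets 0 k | 7 ∈ u} + partsGF (nonMultSets 8 k) := by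
    rw [partsGF, hunion, weightGF_union finite_sum_preimage hdisj, ← hunion]
  rw [partsGF_nonMultSets (by lia), partsGF_nonMultSets (by lia), boundarySeries_zero,
    noSevenSeries, map_add] at hsum
  linear_combination -hsum

theorem choose_two_add_two_mul (i k : ℕ) :
    (i + 2 * k).choose 2 = i.choose 2 + (2 * i + 1) * k + 4 * k.choose 2 := by
  induction k with
  | zero => simp
  | succ k ih =>
    rw [Nat.mul_succ, ← add_assoc, Nat.choose_succ_succ' (i + 2 * k + 1) 1,
      Nat.choose_succ_succ' (i + 2 * k) 1, Nat.choose_succ_succ' k 1, ih]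
    simp only [Nat.choose_one_right]
    ring

theorem pow_choose_mul_partsGF_multSets (l i j : ℕ) :
    (X ^ 15) ^ i.choose 2 * partsGF (multSets (l + 1 + 2 * i) j) =
      (X ^ 15) ^ (i + j).choose 2 * coeff j (invSqSeries (X ^ 15) ((X ^ 15) ^ l)) := by
  rw [invSqSeries, coeff_expand]
  split_ifs with h
  · obtain ⟨k, rfl⟩ := h
    have hspaced : multSets (l + 1 + 2 * i) (2 * k) =
        spaced (fun x y => x + 15 * 4 ≤ y) (15 ∣ ·) (15 * (l + 1 + 2 * i)) k := by
      ext v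
      simp only [multSets, spaced, Set.mem_ofPred_eq, true_and]
      lia
    rw [hspaced, partsGF_spaced_dvd (by lia) (by lia), choose_two_add_two_mul,
      Nat.mul_div_cancel_left k two_pos, invSeries, coeff_mk]
    ring
  · have hempty : multSets (l + 1 + 2 * i) j = ∅ :=
      Set.eq_empty_of_forall_notMem fun v hv => h ⟨#v, hv.1.symm⟩
    rw [hempty, partsGF, ← coe_empty, weightGF_coe_finset, sum_empty, mul_zero, mul_zero]

theorem stairCoeff_gapSeries (n : ℕ) : stairCoeff (X ^ 15) n gapSeries =
    ∑ ij ∈ HasAntidiagonal.antidiagonal n,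
      (partsGF {u ∈ nonMultSets 0 ij.1 | 7 ∈ u} * partsGF (multSets (2 + 2 * ij.1) ij.2) +
        partsGF (nonMultSets 8 ij.1) * partsGF (multSets (3 + 2 * ij.1) ij.2)) := by
  rw [gapSeries, stairCoeff_apply, map_add, coeff_mul, coeff_mul, ← sum_add_distrib, mul_sum]
  refine sum_congr rfl fun ij hij => ?_
  have hone := pow_choose_mul_partsGF_multSets 1 ij.1 ij.2
  have htwo := pow_choose_mul_partsGF_multSets 2 ij.1 ij.2
  rw [pow_one] at hone
  rw [← HasAntidiagonal.mem_antidiagonal.1 hij, partsGF_nonMultSets_seven_mem,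
    partsGF_nonMultSets (by lia), ← noSevenSeries, stairCoeff_apply, stairCoeff_apply]
  linear_combination (-coeff ij.1 sevenSeries) * hone - coeff ij.1 noSevenSeries * htwo

end PartsModFifteen

section Partitions

theorem card_partition_eq_coeff_partsGF {P : Multiset ℕ → Prop} [DecidablePred P]
    (hnodup : ∀ s, P s → s.Nodup) (hzero : ∀ s, P s → 0 ∉ s) (n : ℕ) :
    (#{c : Nat.Partition n | P c.parts} : ℤ) = coeff n (partsGF {s | P s.val}) := by
  rw [coeff_weightGF, Nat.cast_inj, ← Set.ncard_coe_finset]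
  refine Set.ncard_congr (fun c hc => ⟨c.parts, hnodup _ (mem_filter.1 hc).2⟩) ?_ ?_ ?_
  · intro c hc
    exact ⟨(mem_filter.1 hc).2, (sum_val _).symm.trans c.parts_sum⟩
  · intro c c' hc hc' h
    exact Nat.Partition.ext (congrArg Finset.val h)
  · rintro s ⟨hs, hsum⟩
    have hpos {i : ℕ} (hi : i ∈ s.val) : 0 < i :=
      Nat.pos_of_ne_zero (ne_of_mem_of_not_mem hi (hzero _ hs))
    exact ⟨⟨s.val, hpos, (sum_val s).trans hsum⟩, by simpa using hs, rfl⟩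

theorem not_isNegPowClass_zero : ¬ IsNegPowClass 0 := by decide

theorem zero_notMem_of_isPThree {s : Multiset ℕ} (h : IsPThree s) : 0 ∉ s :=
  fun h0 => not_isNegPowClass_zero (h.2 0 h0)

theorem zero_notMem_of_isGThree {s : Multiset ℕ} (h : IsGThree s) : 0 ∉ s :=
  fun h0 => Nat.not_lt_zero 15 (h.large 0 h0 not_isNegPowClass_zero)

theorem nodup_of_forall_mem_erase {α : Type*} [Preorder α] [DecidableEq α] {s : Multiset α}
    {r : α → α → Prop} (hr : ∀ x, ¬ r x x) (h : ∀ x ∈ s, ∀ y ∈ s.erase x, x ≤ y → r x y) :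
    s.Nodup := by
  rw [Multiset.nodup_iff_count_le_one]
  intro x
  by_contra! hx
  exact hr x (h x (Multiset.count_pos.1 (by lia)) x
    (Multiset.count_pos.1 (by rw [Multiset.count_erase_self]; lia)) le_rfl)

theorem nodup_of_isGThree {s : Multiset ℕ} (h : IsGThree s) : s.Nodup := by
  have hmult : (multiplesPart s).Nodup := nodup_of_forall_mem_erase (by lia) h.gap_mult
  have hnon : (nonMultiplesPart s).Nodup := nodup_of_forall_mem_erase (by lia) h.gap
  rw [← Multiset.filter_add_not (15 ∣ ·) s]
  refine Multiset.nodup_add.2 ⟨hmult, hnon, Multiset.disjoint_left.2 fun hx hx' => ?_⟩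
  exact (Multiset.mem_filter.1 hx').2 (Multiset.mem_filter.1 hx).2

theorem forall_mem_erase_val_iff {α : Type*} [PartialOrder α] [DecidableEq α] {t : Finset α}
    {r : α → α → Prop} :
    (∀ x ∈ t.val, ∀ y ∈ t.val.erase x, x ≤ y → r x y) ↔ ∀ x ∈ t, ∀ y ∈ t, x < y → r x y := by
  simp only [t.nodup.mem_erase_iff, mem_val, lt_iff_le_and_ne]
  grind

theorem gapRel_isNegPowClass_iff (x y : ℕ) : gapRel 15 IsNegPowClass x y ↔
    x + 15 ≤ y ∧ (y = x + 15 → IsNegPowClass x ∨ IsNegPowClass y) := by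
  refine and_congr_right fun _ => forall_congr' fun h => ?_
  rw [h, isNegPowClass_add_fifteen, or_self]

theorem isNegPowClass_or_isPairClass_iff {x : ℕ} (hx : ¬ 15 ∣ x) :
    IsNegPowClass x ∨ IsPairClass x ∧ 15 ≤ x ↔
      ¬ IsPosPowClass x ∧ (¬ IsNegPowClass x → 15 < x) := by
  simp only [IsPairClass, isNegPowClass_iff, isPosPowClass_iff]
  lia

theorem isGThree_val_iff (s : Finset ℕ) : IsGThree s.val ↔
    s.filter (¬ 15 ∣ ·) ∈ nonMultSets 0 #(s.filter (¬ 15 ∣ ·)) ∧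
      s.filter (15 ∣ ·) ∈ multSets ((if 7 ∈ s then 2 else 3) + 2 * #(s.filter (¬ 15 ∣ ·)))
        (2 * #(s.filter (15 ∣ ·))) := by
  have hmult : multiplesPart s.val = (s.filter (15 ∣ ·)).val := rfl
  have hnon : nonMultiplesPart s.val = (s.filter (¬ 15 ∣ ·)).val := rfl
  have hbound : (if 7 ∈ s then 30 else 45) + 30 * #(s.filter (¬ 15 ∣ ·)) =
      15 * ((if 7 ∈ s then 2 else 3) + 2 * #(s.filter (¬ 15 ∣ ·))) := by
    split_ifs <;> ring
  constructor
  · rintro ⟨hpos, hgap, hlarge, hgap', hlower⟩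
    simp only [hnon, ← gapRel_isNegPowClass_iff, forall_mem_erase_val_iff] at hgap
    simp only [hmult, forall_mem_erase_val_iff] at hgap'
    refine ⟨⟨rfl, hgap, fun x hx => ⟨x.zero_le, ?_⟩⟩, rfl, rfl, hgap', fun x hx =>
      ⟨hbound ▸ hlower x hx, (mem_filter.1 hx).2⟩⟩
    obtain ⟨hx, h15⟩ := mem_filter.1 hx
    exact (isNegPowClass_or_isPairClass_iff h15).2 ⟨hpos x hx, hlarge x hx⟩
  · rintro ⟨⟨-, hgap, hmem⟩, -, -, hgap', hmem'⟩
    have hclass (x : ℕ) (hx : x ∈ s) (h15 : ¬ 15 ∣ x) :=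
      (isNegPowClass_or_isPairClass_iff h15).1 (hmem x (mem_filter.2 ⟨hx, h15⟩)).2
    have hlower (x : ℕ) (hx : x ∈ s.filter (15 ∣ ·)) := hbound.trans_le (hmem' x hx).1
    refine ⟨fun x hx => ?_, ?_, fun x hx => ?_, ?_, hlower⟩
    · by_cases h15 : 15 ∣ x
      · rw [isPosPowClass_iff]
        lia
      · exact (hclass x hx h15).1
    · simpa only [hnon, ← gapRel_isNegPowClass_iff, forall_mem_erase_val_iff] using hgap
    · by_cases h15 : 15 ∣ x
      · have := hlower x (mem_filter.2 ⟨hx, h15⟩)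
        grind
      · exact (hclass x hx h15).2
    · simpa only [hmult, forall_mem_erase_val_iff] using hgap'

/-- The sets satisfying the difference conditions with `i` elements that are not multiples of `15`
and `j / 2` multiples of `15`. -/
def gapSets (i j : ℕ) : Set (Finset ℕ) :=
  {s | IsGThree s.val ∧ #(s.filter (¬ 15 ∣ ·)) = i ∧ 2 * #(s.filter (15 ∣ ·)) = j}

theorem gapSets_eq (i j : ℕ) : gapSets i j =
    Set.image2 (· ∪ ·) {u ∈ nonMultSets 0 i | 7 ∈ u} (multSets (2 + 2 * i) j) ∪
      Set.image2 (· ∪ ·) (nonMultSets 8 i) (multSets (3 + 2 * i) j) := by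
  rw [nonMultSets_eight]
  ext s
  constructor
  · rintro ⟨hs, rfl, rfl⟩
    obtain ⟨hu, hv⟩ := (isGThree_val_iff s).1 hs
    have hunion : s.filter (¬ 15 ∣ ·) ∪ s.filter (15 ∣ ·) = s := by
      rw [union_comm, filter_union_filter_not_eq]
    by_cases h7 : 7 ∈ s
    · rw [if_pos h7] at hv
      exact .inl ⟨_, ⟨hu, by simpa using h7⟩, _, hv, hunion⟩
    · rw [if_neg h7] at hv
      exact .inr ⟨_, ⟨hu, by simpa using h7⟩, _, hv, hunion⟩
  · have union_mem {u v : Finset ℕ} (hu : u ∈ nonMultSets 0 i)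
        (hv : v ∈ multSets ((if 7 ∈ u then 2 else 3) + 2 * i) j) : u ∪ v ∈ gapSets i j := by
      obtain ⟨hu', hv'⟩ := filter_union_of_forall (not_dvd_of_mem_nonMultSets hu)
        (dvd_of_mem_multSets hv)
      have h7 : 7 ∈ u ∪ v ↔ 7 ∈ u :=
        mem_union.trans (or_iff_left fun h => absurd (dvd_of_mem_multSets hv 7 h) (by decide))
      refine ⟨(isGThree_val_iff _).2 ?_, by rw [hu', hu.1], by rw [hv', hv.1]⟩
      simpa only [hu', hv', hu.1, hv.1, h7] using ⟨hu, hv⟩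
    rintro (⟨u, ⟨hu, h7⟩, v, hv, rfl⟩ | ⟨u, ⟨hu, h7⟩, v, hv, rfl⟩)
    · exact union_mem hu (by rwa [if_pos h7])
    · exact union_mem hu (by rwa [if_neg h7])

theorem partsGF_gapSets (i j : ℕ) : partsGF (gapSets i j) =
    partsGF {u ∈ nonMultSets 0 i | 7 ∈ u} * partsGF (multSets (2 + 2 * i) j) +
      partsGF (nonMultSets 8 i) * partsGF (multSets (3 + 2 * i) j) := by
  have hdisj : Disjoint
      (Set.image2 (· ∪ ·) {u ∈ nonMultSets 0 i | 7 ∈ u} (multSets (2 + 2 * i) j))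
      (Set.image2 (· ∪ ·) (nonMultSets 8 i) (multSets (3 + 2 * i) j)) := by
    rw [nonMultSets_eight, Set.disjoint_left]
    rintro _ ⟨u, ⟨-, h7⟩, v, -, rfl⟩ ⟨u', ⟨-, h7'⟩, v', hv', (h : u' ∪ v' = u ∪ v)⟩
    rcases mem_union.1 (h ▸ mem_union_left v h7) with h | h
    · exact h7' h
    · exact absurd (dvd_of_mem_multSets hv' 7 h) (by decide)
  rw [gapSets_eq, partsGF, weightGF_union finite_sum_preimage hdisj,
    ← partsGF_image2_union (c := (15 ∣ ·)) (fun u hu => not_dvd_of_mem_nonMultSets hu.1)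
      (fun v => dvd_of_mem_multSets),
    ← partsGF_image2_union (c := (15 ∣ ·)) (fun u => not_dvd_of_mem_nonMultSets)
      (fun v => dvd_of_mem_multSets)]

theorem card_le_sum_of_zero_notMem {s : Finset ℕ} (h : 0 ∉ s) : #s ≤ ∑ x ∈ s, x := by
  rw [card_eq_sum_ones]
  exact sum_le_sum fun x hx => Nat.one_le_iff_ne_zero.2 (ne_of_mem_of_not_mem hx h)

theorem coeff_stairSum_gapSeries {n B : ℕ} (hB : 2 * n < B) :
    coeff n (stairSum (X ^ 15) B gapSeries) = GThree n := by
  let number (s : Finset ℕ) : ℕ × ℕ := (#(s.filter (¬ 15 ∣ ·)), 2 * #(s.filter (15 ∣ ·)))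
  have hnumber : ∀ s ∈ {s : Finset ℕ | IsGThree s.val}, ∑ x ∈ s, x = n →
      (number s).1 + (number s).2 ∈ range B := fun s hs hsum => by
    have hcard := card_filter_add_card_filter_not (s := s) (15 ∣ ·)
    have hle := card_le_sum_of_zero_notMem (zero_notMem_of_isGThree hs)
    simp only [number, mem_range]
    lia
  rw [GThree, card_partition_eq_coeff_partsGF (fun _ => nodup_of_isGThree)
      (fun _ => zero_notMem_of_isGThree),
    coeff_weightGF_eq_sum_fiber (finite_sum_preimage n) hnumber, stairSum_apply, map_sum]
  refine sum_congr rfl fun k _ => ?_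
  rw [coeff_weightGF_eq_sum_fiber (finite_sum_preimage n) (f := number)
    (I := HasAntidiagonal.antidiagonal k) (fun s hs _ => HasAntidiagonal.mem_antidiagonal.2 hs.2),
    stairCoeff_gapSeries, map_sum]
  refine sum_congr rfl fun ij hij => ?_
  rw [← partsGF_gapSets]
  congr 2
  ext s
  rw [HasAntidiagonal.mem_antidiagonal] at hij
  simp only [gapSets, number, Set.mem_ofPred_eq, Prod.ext_iff]
  lia

theorem prod_range_eq_prod_isNegPowClass (m : ℕ) : ∏ t ∈ range m,
    ((1 + X ^ 7 * (X ^ 15) ^ t) * (1 + X ^ 11 * (X ^ 15) ^ t) * (1 + X ^ 13 * (X ^ 15) ^ t) *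
      (1 + X ^ 14 * (X ^ 15) ^ t)) =
    ∏ x ∈ range (15 * m) with IsNegPowClass x, (1 + X ^ x : ℤ⟦X⟧) := by
  rw [prod_filter]
  induction m with
  | zero => simp
  | succ m ih =>
    rw [prod_range_succ, ih, Nat.mul_succ, prod_range_add]
    congr 1
    simp [prod_range_succ, isNegPowClass_iff, ← pow_mul, ← pow_add, add_comm]

theorem coeff_prod_isNegPowClass {n m : ℕ} (hm : n < m) :
    coeff n (∏ x ∈ range m with IsNegPowClass x, (1 + X ^ x : ℤ⟦X⟧)) = PThree n := by
  rw [PThree, card_partition_eq_coeff_partsGF (P := IsPThree) (fun _ => And.left)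
      (fun _ => zero_notMem_of_isPThree),
    ← partsGF_powerset, coeff_weightGF, coeff_weightGF]
  congr 2
  ext s
  refine and_congr_left fun (hsum : ∑ x ∈ s, x = n) => ?_
  have hlt (x : ℕ) (hx : x ∈ s) : x < m :=
    ((single_le_sum_of_canonicallyOrdered hx).trans_eq hsum).trans_lt hm
  simp only [mem_coe, mem_powerset, subset_iff, mem_filter, mem_range, Set.mem_ofPred_eq, IsPThree,
    s.nodup, mem_val, true_and]
  exact forall₂_congr fun x hx => and_iff_right (hlt x hx)

theorem X_pow_dvd_stairSum_gapSeries_sub (m : ℕ) :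
    ((X : ℤ⟦X⟧) ^ 15) ^ m ∣ stairSum (X ^ 15) (m + 5) gapSeries -
      ∏ x ∈ range (15 * (m + 1)) with IsNegPowClass x, (1 + X ^ x) := by
  have hreg : IsLeftRegular ((X : ℤ⟦X⟧) ^ 15) :=
    IsLeftCancelMulZero.mul_left_cancel_of_ne_zero (pow_ne_zero 15 X_ne_zero)
  have h := pow_dvd_quadSum_sub_prod (isUnit_one_sub_X_pow_pow (by lia)) hreg (m + 1)
    (a := X ^ 7) (b := X ^ 11) (c := X ^ 13) (d := X ^ 14) (ε := X ^ 15) (by ring)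
  rwa [quadSum, ← C_mul_gapSeries, stairSum_C_mul, ← mul_sub, pow_succ',
    hreg.dvd_cancel_left, prod_range_eq_prod_isNegPowClass] at h

end Partitions

end GollnitzFour

theorem theorem3 (n : ℕ) : GThree n = PThree n := by
  have hdvd := GollnitzFour.X_pow_dvd_stairSum_gapSeries_sub (2 * n + 1)
  rw [← pow_mul] at hdvd
  have hcoeff := PowerSeries.X_pow_dvd_iff.1 hdvd n (by lia)
  rw [map_sub, GollnitzFour.coeff_stairSum_gapSeries (by lia),
    GollnitzFour.coeff_prod_isNegPowClass (by lia)] at hcoeff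
  exact_mod_cast sub_eq_zero.1 hcoeff
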